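/- Let $k\ge 3$, let $\mathcal H$ be a connected $k$-uniform hypergraph with vertex set $[n]=\{1,\dots,n\}$ and at least one edge (edges are $k$-element subsets of $[n]$, and connected means that any two vertices are joined by a sequence of vertices in which consecutive ones lie in a common edge), and let $b_1,\dots,b_n>0$ be real numbers. Let $\mathbb A(\mathcal H)$ be the adjacency tensor of $\mathcal H$, that is, the order $k$, dimension $n$ tensor with entries $a_{i_1\dots i_k}=\frac1{(k-1)!}$ if $\{i_1,\dots,i_k\}\in E(\mathcal H)$ and $a_{i_1\dots i_k}=0$ otherwise. A number $\lambda\in\mathbb C$ is an eigenvalue of $\mathbb A(\mathcal H)$ if there is a nonzero $x\in\mathbb C^n$ with $\sum_{i_2,\dots,i_k=1}^n a_{ii_2\dots i_k}x_{i_2}\cdots x_{i_k}=\lambda x_i^{k-1}$ for all $i\in[n]$; the maximum of $|\lambda|$ over all eigenvalues $\lambda$ exists and is denoted by $\rho(\mathbb A(\mathcal H))$. For $i\in[n]$ put $$b'_i=b_i^{-(k-1)}\sum_{\{i,i_2,\dots,i_k\}\in E(\mathcal H)}b_{i_2}\cdots b_{i_k},$$ where the sum has one term for each edge containing $i$. Then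 $$\min_{e\in E(\mathcal H)}\ \min_{\{i,j\}\subseteq e,\ i\ne j}\sqrt{b'_ib'_j}\ \le\ \rho(\mathbb A(\mathcal H))\ \le\ \max_{e\in E(\mathcal H)}\ \max_{\{i,j\}\subseteq e,\ i\ne j}\sqrt{b'_ib'_j}.$$ Moreover, for each of these two inequalities, equality holds if and only if $b'_i=b'_j$ for all $i,j\in[n]$. -/

import Mathlib

noncomputable section

open scoped Classical in
/-- The finite set of ordered pairs `(i, j)` of distinct vertices that lie in a common edge. -/
def Hypergraph.adjPairs {n : ℕ} (H : Hypergraph (Fin n)) : Finset (Fin n × Fin n) :=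
  Finset.univ.filter fun p => p.1 ≠ p.2 ∧ ∃ e ∈ H.edgeSet, p.1 ∈ e ∧ p.2 ∈ e

/-- `H` is `k`-uniform: every edge has exactly `k` vertices. -/
def Hypergraph.IsUniform {n : ℕ} (H : Hypergraph (Fin n)) (k : ℕ) : Prop :=
  ∀ e ∈ H.edgeSet, e.ncard = k

/-- `H` is connected: any two vertices `u`, `v` are joined by a walk
`u = v₀, e₁, v₁, …, e_l, v_l = v`, where each `e_{i+1}` is an edge containing `v_i` and `v_{i+1}`.
Here `H.Adj x y` says that some edge contains both `x` and `y`. -/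
def Hypergraph.IsConnected {n : ℕ} (H : Hypergraph (Fin n)) : Prop :=
  ∀ u ∈ H.vertexSet, ∀ v ∈ H.vertexSet, Relation.ReflTransGen H.Adj u v

theorem Hypergraph.adjPairs_nonempty {n k : ℕ} {H : Hypergraph (Fin n)} (hk : 3 ≤ k)
    (hH : H.IsUniform k) (hE : H.edgeSet.Nonempty) : H.adjPairs.Nonempty := by
  classical
  obtain ⟨e, he⟩ := hE
  have h1 : 1 < e.ncard := by rw [hH e he]; omega
  obtain ⟨a, ha, b, hb, hab⟩ := (Set.one_lt_ncard (Set.toFinite e)).1 h1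
  exact ⟨(a, b), Finset.mem_filter.2 ⟨Finset.mem_univ _, hab, e, he, ha, hb⟩⟩

/-- A complex tensor of order `m ≥ 1` and dimension `n`: the entry `a_{i i₂ … i_m}` is `A i t`,
where `t = (i₂, …, i_m)`. -/
abbrev CTensor (m n : ℕ) : Type := Fin n → (Fin (m - 1) → Fin n) → ℂ

namespace CTensor

variable {m n : ℕ}

/-- The vector `A x^{m-1}`, with `i`-th component `∑_{i₂, …, i_m} a_{i i₂ … i_m} x_{i₂} ⋯ x_{i_m}`. -/
def apply (A : CTensor m n) (x : Fin n → ℂ) : Fin n → ℂ :=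
  fun i => ∑ t : Fin (m - 1) → Fin n, A i t * ∏ s, x (t s)

/-- `μ` is an eigenvalue of `A`: there is a nonzero complex vector `x` with
`(A x^{m-1})_i = μ x_i^{m-1}` for all `i`. -/
def IsEigenvalue (A : CTensor m n) (μ : ℂ) : Prop :=
  ∃ x : Fin n → ℂ, x ≠ 0 ∧ ∀ i, A.apply x i = μ * x i ^ (m - 1)

/-- The set of moduli of the eigenvalues of `A`. -/
def eigenvalueModuli (A : CTensor m n) : Set ℝ :=
  {r | ∃ μ : ℂ, A.IsEigenvalue μ ∧ r = ‖μ‖}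

/-- The spectral radius: the largest modulus of an eigenvalue. -/
def spectralRadius (A : CTensor m n) : ℝ := sSup A.eigenvalueModuli

end CTensor

open scoped Classical in
/-- The adjacency tensor of order `k`: the entry at `i₁ i₂ … i_k` is `1 / (k-1)!` if
`{i₁, i₂, …, i_k}` is an edge, and `0` otherwise. -/
def Hypergraph.adjacencyTensor {n : ℕ} (H : Hypergraph (Fin n)) (k : ℕ) : CTensor k n :=
  fun i t => if insert i (Set.range t) ∈ H.edgeSet then 1 / ((k - 1).factorial : ℂ) else 0

open scoped Classical in
/-- `b'_i = b_i^{-(k-1)} ∑_{e} ∏_{j ∈ e, j ≠ i} b_j`, the sum being over the edges `e`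
containing `i`. -/
def Hypergraph.weightedDegree {n : ℕ} (H : Hypergraph (Fin n)) (k : ℕ) (b : Fin n → ℝ)
    (i : Fin n) : ℝ :=
  (b i ^ (k - 1))⁻¹ *
    ∑ e ∈ Finset.univ.filter (fun e : Finset (Fin n) => (e : Set (Fin n)) ∈ H.edgeSet ∧ i ∈ e),
      ∏ j ∈ e.erase i, b j

end

/-! Perron–Frobenius plus a comparison of two eigen-equations. Maximizing the edge polynomial
`edgeSum` over nonnegative vectors with `∑ x i ^ k = 1` yields, by connectedness, a positive
eigenvector `x` whose eigenvalue `r` bounds the modulus of every eigenvalue; so `r` is the spectral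
radius.

Write `d` for the weighted degrees and `y i = x i / b i`. Take `i` with `y i` maximal and `j` with
`y j` maximal among the neighbours of `i`. The equations at `i` and `j` give `r * y i ^ (k-1) ≤ d i
* y j ^ (k-1)` and `r * y j ^ (k-1) ≤ d j * y i ^ (k-1)`; multiplying, the powers of `y` cancel and
`r ^ 2 ≤ d i * d j`. One of the two is strict unless every neighbour of `i` also attains the
maximum, so if no adjacent product exceeds `r ^ 2`, then `y` is constant by connectedness and `d` is
constantly `r` (`linkSum_eq_of_forall_mul_le`). Minima give the mirror statement
(`linkSum_eq_of_forall_le_mul`). These two rigidity lemmas contain both the bounds and the equality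
cases. -/

section EdgeFamily

variable {ι : Type*}

/-! ### Perron–Frobenius theory of the edge polynomial -/

/-- The sum over the members of `E` of the products of `x`. -/
def edgeSum {R : Type*} [CommSemiring R] (E : Finset (Finset ι)) (x : ι → R) : R :=
  ∑ e ∈ E, ∏ j ∈ e, x j

theorem edgeSum_nonneg (E : Finset (Finset ι)) {x : ι → ℝ} (hx : ∀ i, 0 ≤ x i) :
    0 ≤ edgeSum E x :=
  Finset.sum_nonneg fun _ _ => Finset.prod_nonneg fun j _ => hx j

theorem edgeSum_const_mul {R : Type*} [CommSemiring R] {E : Finset (Finset ι)} {k : ℕ}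
    (hE : ∀ e ∈ E, e.card = k) (c : R) (x : ι → R) :
    edgeSum E (fun i => c * x i) = c ^ k * edgeSum E x := by
  rw [edgeSum, edgeSum, Finset.mul_sum]
  refine Finset.sum_congr rfl fun e he => ?_
  rw [Finset.prod_mul_distrib, Finset.prod_const, hE e he]

/-- A property that passes to all vertices sharing a member of a connected family holds everywhere. -/
theorem forall_of_step {E : Finset (Finset ι)}
    (hconn : ∀ u v, Relation.ReflTransGen (fun u v => ∃ e ∈ E, u ∈ e ∧ v ∈ e) u v)
    {P : ι → Prop} {u : ι} (hu : P u)
    (hstep : ∀ e ∈ E, ∀ i ∈ e, P i → ∀ j ∈ e, P j) (v : ι) : P v := by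
  induction hconn u v with
  | refl => exact hu
  | tail _ h ih =>
    obtain ⟨e, he, h1, h2⟩ := h
    exact hstep e he _ h1 ih _ h2

variable [DecidableEq ι]

/-- The sum over the members of `E` containing `i` of the products of `x` over the other vertices. -/
def linkSum {R : Type*} [CommSemiring R] (E : Finset (Finset ι)) (x : ι → R) (i : ι) : R :=
  ∑ e ∈ E with i ∈ e, ∏ j ∈ e.erase i, x j

/-- Euler's identity: `linkSum` is the gradient of `edgeSum`, which is homogeneous of degree `k`. -/
theorem sum_mul_linkSum {R : Type*} [CommSemiring R] [Fintype ι] {E : Finset (Finset ι)} {k : ℕ}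
    (hE : ∀ e ∈ E, e.card = k) (x : ι → R) :
    ∑ i, x i * linkSum E x i = k * edgeSum E x := by
  have h1 : ∀ i, x i * linkSum E x i = ∑ e ∈ E, if i ∈ e then ∏ j ∈ e, x j else 0 := by
    intro i
    rw [linkSum, Finset.mul_sum, ← Finset.sum_filter]
    refine Finset.sum_congr rfl fun e he => ?_
    exact Finset.mul_prod_erase e x (Finset.mem_filter.1 he).2
  simp_rw [h1]
  rw [Finset.sum_comm, edgeSum, Finset.mul_sum]
  refine Finset.sum_congr rfl fun e he => ?_
  rw [← Finset.sum_filter, Finset.sum_const, Finset.filter_univ_mem, hE e he, nsmul_eq_mul]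

theorem linkSum_const_mul {R : Type*} [CommSemiring R] {E : Finset (Finset ι)} {k : ℕ}
    (hE : ∀ e ∈ E, e.card = k) (c : R) (x : ι → R) (i : ι) :
    linkSum E (fun i => c * x i) i = c ^ (k - 1) * linkSum E x i := by
  rw [linkSum, linkSum, Finset.mul_sum]
  refine Finset.sum_congr rfl fun e he => ?_
  rw [Finset.mem_filter] at he
  rw [Finset.prod_mul_distrib, Finset.prod_const, Finset.card_erase_of_mem he.2, hE e he.1]

theorem edgeSum_update (E : Finset (Finset ι)) (x : ι → ℝ) (i : ι) (s : ℝ) :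
    edgeSum E (Function.update x i s) = edgeSum E x + (s - x i) * linkSum E x i := by
  rw [edgeSum, edgeSum, linkSum, Finset.sum_filter, Finset.mul_sum, ← Finset.sum_add_distrib]
  refine Finset.sum_congr rfl fun e _ => ?_
  by_cases hi : i ∈ e
  · rw [Finset.prod_update_of_mem hi, if_pos hi, Finset.sdiff_singleton_eq_erase,
      ← Finset.mul_prod_erase e x hi]
    ring
  · rw [Finset.prod_update_of_notMem hi, if_neg hi]
    ring

theorem linkSum_le_linkSum {E : Finset (Finset ι)} {x z : ι → ℝ} {i : ι} (hx : ∀ j, 0 < x j)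
    (h : ∀ e ∈ E, i ∈ e → ∀ j ∈ e, j ≠ i → x j ≤ z j) : linkSum E x i ≤ linkSum E z i := by
  refine Finset.sum_le_sum fun e he => Finset.prod_le_prod (fun j _ => (hx j).le) fun j hj => ?_
  rw [Finset.mem_filter] at he
  rw [Finset.mem_erase] at hj
  exact h e he.1 he.2 j hj.2 hj.1

theorem linkSum_lt_linkSum {E : Finset (Finset ι)} {x z : ι → ℝ} {i : ι} (hx : ∀ j, 0 < x j)
    (h : ∀ e ∈ E, i ∈ e → ∀ j ∈ e, j ≠ i → x j ≤ z j) {e : Finset ι} (he : e ∈ E) (hi : i ∈ e)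
    {j : ι} (hj : j ∈ e) (hji : j ≠ i) (hlt : x j < z j) : linkSum E x i < linkSum E z i := by
  refine Finset.sum_lt_sum (fun e he => Finset.prod_le_prod (fun j _ => (hx j).le) fun j hj => ?_)
    ⟨e, Finset.mem_filter.2 ⟨he, hi⟩, Finset.prod_lt_prod (fun j _ => hx j) (fun j hj => ?_)
      ⟨j, Finset.mem_erase.2 ⟨hji, hj⟩, hlt⟩⟩
  · rw [Finset.mem_filter] at he
    rw [Finset.mem_erase] at hj
    exact h e he.1 he.2 j hj.2 hj.1
  · rw [Finset.mem_erase] at hj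
    exact h e he hi j hj.2 hj.1

/-- Compactness gives a maximizer on the nonnegative part of the `ℓ^k` unit sphere; homogeneity
removes the normalization of `z`. -/
theorem exists_edgeSum_maximizer [Fintype ι] [Nonempty ι] {E : Finset (Finset ι)} {k : ℕ}
    (hk : k ≠ 0) (hE : ∀ e ∈ E, e.card = k) :
    ∃ x : ι → ℝ, (∀ i, 0 ≤ x i) ∧ ∑ i, x i ^ k = 1 ∧
      ∀ z : ι → ℝ, (∀ i, 0 ≤ z i) → edgeSum E z ≤ edgeSum E x * ∑ i, z i ^ k := by
  let S : Set (ι → ℝ) := {x | (∀ i, 0 ≤ x i) ∧ ∑ i, x i ^ k = 1}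
  have hclosed : IsClosed S := by
    refine IsClosed.inter ?_ ?_
    · exact isClosed_le (f := fun _ : ι → ℝ => (0 : ι → ℝ)) continuous_const continuous_id
    · exact isClosed_eq (by fun_prop) continuous_const
  have hsub : S ⊆ Set.Icc 0 1 := by
    intro x hx
    refine ⟨fun i => hx.1 i, fun i => ?_⟩
    have h1 : x i ^ k ≤ 1 := by
      rw [← hx.2]
      exact Finset.single_le_sum (f := fun i => x i ^ k) (fun j _ => pow_nonneg (hx.1 j) k)
        (Finset.mem_univ i)
    exact (pow_le_one_iff_of_nonneg (hx.1 i) hk).1 h1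
  have hcomp : IsCompact S := isCompact_Icc.of_isClosed_subset hclosed hsub
  have hne : S.Nonempty := by
    obtain ⟨a⟩ := ‹Nonempty ι›
    refine ⟨Pi.single a 1, fun i => ?_, ?_⟩
    · by_cases h : i = a
      · subst h; simp
      · simp [h]
    · rw [Finset.sum_eq_single a]
      · simp
      · intro j _ hj; simp [hj, hk]
      · simp
  obtain ⟨x, hxS, hmax⟩ := hcomp.exists_isMaxOn hne
    (f := edgeSum E) (by unfold edgeSum; fun_prop)
  refine ⟨x, hxS.1, hxS.2, fun z hz => ?_⟩
  have hN : 0 ≤ ∑ i, z i ^ k := Finset.sum_nonneg fun i _ => pow_nonneg (hz i) k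
  rcases hN.eq_or_lt with h0 | hpos
  · have hz0 : ∀ i, z i = 0 := fun i => by
      have := (Finset.sum_eq_zero_iff_of_nonneg (fun i _ => pow_nonneg (hz i) k)).1 h0.symm i
        (Finset.mem_univ i)
      exact pow_eq_zero_iff hk |>.1 this
    rw [← h0, mul_zero]
    refine (Finset.sum_eq_zero fun e he => ?_).le
    have : e.Nonempty := by
      rw [← Finset.card_pos, hE e he]; omega
    obtain ⟨j, hj⟩ := this
    exact Finset.prod_eq_zero hj (hz0 j)
  · set c : ℝ := (∑ i, z i ^ k) ^ ((k : ℝ)⁻¹) with hc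
    have hck : c ^ k = ∑ i, z i ^ k := Real.rpow_inv_natCast_pow hN hk
    have hcpos : 0 < c := Real.rpow_pos_of_pos hpos _
    have hmem : (fun i => c⁻¹ * z i) ∈ S := by
      refine ⟨fun i => mul_nonneg (inv_nonneg.2 hcpos.le) (hz i), ?_⟩
      simp_rw [mul_pow]
      rw [← Finset.mul_sum, ← hck, ← mul_pow, inv_mul_cancel₀ hcpos.ne', one_pow]
    have h2 : edgeSum E (fun i => c⁻¹ * z i) ≤ edgeSum E x := hmax hmem
    rw [edgeSum_const_mul hE, inv_pow, hck, inv_mul_le_iff₀ hpos] at h2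
    linarith

/-- If an edge mixes zero and nonzero coordinates, raise all zero coordinates to `t`. That edge,
with `m < k` zeros, gains order `t ^ m`, while the norm grows only by order `t ^ k`, contradicting
maximality for small `t`. -/
theorem edgeSum_maximizer_pos [Fintype ι] {E : Finset (Finset ι)} {k : ℕ}
    (hk : k ≠ 0) (hE : ∀ e ∈ E, e.card = k)
    (hconn : ∀ u v, Relation.ReflTransGen (fun u v => ∃ e ∈ E, u ∈ e ∧ v ∈ e) u v)
    {x : ι → ℝ} (hx : ∀ i, 0 ≤ x i) (hx1 : ∑ i, x i ^ k = 1)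
    (hmax : ∀ z : ι → ℝ, (∀ i, 0 ≤ z i) → edgeSum E z ≤ edgeSum E x * ∑ i, z i ^ k) (i : ι) :
    0 < x i := by
  have hex : ∃ u, 0 < x u := by
    by_contra! h
    have h0 : ∀ i, x i = 0 := fun i => le_antisymm (h i) (hx i)
    simp [h0, hk] at hx1
  obtain ⟨u, hu⟩ := hex
  refine forall_of_step hconn (P := fun i => 0 < x i) hu (fun e he i hi hxi j hj => ?_) i
  by_contra hxj
  have hxj0 : x j = 0 := le_antisymm (not_lt.1 hxj) (hx j)
  set p : ℝ := ∏ l ∈ e with x l ≠ 0, x l with hp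
  set m : ℕ := (e.filter (fun l => x l = 0)).card with hm
  set M : ℕ := (Finset.univ.filter (fun l => x l = 0)).card with hM
  set r := edgeSum E x with hr
  have hr0 : 0 ≤ r := edgeSum_nonneg E hx
  have hppos : 0 < p := Finset.prod_pos fun l hl =>
    lt_of_le_of_ne (hx l) (Ne.symm (Finset.mem_filter.1 hl).2)
  have hMpos : (0 : ℝ) < M := by
    rw [Nat.cast_pos, hM, Finset.card_pos]
    exact ⟨j, by simp [hxj0]⟩
  have hmk : m < k := by
    rw [← hE e he]
    refine Finset.card_lt_card (Finset.filter_ssubset.2 ⟨i, hi, hxi.ne'⟩)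
  have key : ∀ t : ℝ, 0 < t → t ^ m * p ≤ r * (M * t ^ k) := by
    intro t ht
    let z : ι → ℝ := fun l => if x l = 0 then t else x l
    have hz : ∀ l, 0 ≤ z l := fun l => by
      dsimp only [z]; split_ifs; exacts [ht.le, hx l]
    have hxz : ∀ l, x l ≤ z l := fun l => by
      dsimp only [z]; split_ifs with h; exacts [h ▸ ht.le, le_rfl]
    have hNz : ∑ l, z l ^ k = 1 + M * t ^ k := by
      have : ∀ l, z l ^ k = x l ^ k + if x l = 0 then t ^ k else 0 := fun l => by
        dsimp only [z]; split_ifs with h <;> simp [h, hk]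
      simp_rw [this]
      rw [Finset.sum_add_distrib, hx1, ← Finset.sum_filter, Finset.sum_const, nsmul_eq_mul]
    have hze : ∏ l ∈ e, z l = t ^ m * p := by
      rw [← Finset.prod_filter_mul_prod_filter_not e (fun l => x l = 0)]
      congr 1
      · rw [hm, ← Finset.prod_const]
        exact Finset.prod_congr rfl fun l hl => if_pos (Finset.mem_filter.1 hl).2
      · exact Finset.prod_congr rfl fun l hl => if_neg (Finset.mem_filter.1 hl).2
    have hgain : r + t ^ m * p ≤ edgeSum E z := by
      rw [hr, edgeSum, edgeSum, ← Finset.add_sum_erase E _ he, ← Finset.add_sum_erase E _ he,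
        Finset.prod_eq_zero hj hxj0, hze]
      have : ∑ e' ∈ E.erase e, ∏ l ∈ e', x l ≤ ∑ e' ∈ E.erase e, ∏ l ∈ e', z l :=
        Finset.sum_le_sum fun e' _ => Finset.prod_le_prod (fun l _ => hx l) fun l _ => hxz l
      linarith
    have := hmax z hz
    rw [hNz] at this
    linarith
  have hden : 0 < r * M + p := by positivity
  -- Small enough that `r * M * t = p - t * p < p`, against the bound `p ≤ r * M * t` derived from
  -- `key`.
  set t := p / (r * M + p) with ht
  have htpos : 0 < t := div_pos hppos hden
  have ht1 : t ≤ 1 := by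
    rw [ht, div_le_one hden]; linarith [mul_nonneg hr0 hMpos.le]
  have h1 := key t htpos
  have h2 : t ^ k ≤ t ^ m * t := by
    rw [← pow_succ]; exact pow_le_pow_of_le_one htpos.le ht1 hmk
  have h3 : t ^ m * p ≤ t ^ m * (r * M * t) := by
    calc t ^ m * p ≤ r * (M * t ^ k) := h1
      _ ≤ r * (M * (t ^ m * t)) := by gcongr
      _ = _ := by ring
  have h4 : p ≤ r * M * t := le_of_mul_le_mul_left h3 (pow_pos htpos m)
  have h5 : t * (r * M + p) = p := div_mul_cancel₀ _ hden.ne'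
  nlinarith [mul_pos htpos hppos]

/-- Varying one coordinate avoids Lagrange multipliers: `edgeSum` is affine in it with slope
`linkSum`, and the defect `g` in the homogeneous inequality has a local minimum at `x i`. -/
theorem linkSum_edgeSum_maximizer [Fintype ι] {E : Finset (Finset ι)} {k : ℕ}
    {x : ι → ℝ} (hx : ∀ i, 0 < x i) (hx1 : ∑ i, x i ^ k = 1)
    (hmax : ∀ z : ι → ℝ, (∀ i, 0 ≤ z i) → edgeSum E z ≤ edgeSum E x * ∑ i, z i ^ k) (i : ι) :
    linkSum E x i = k * edgeSum E x * x i ^ (k - 1) := by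
  let g : ℝ → ℝ := fun s =>
    edgeSum E x * (1 - x i ^ k + s ^ k) - (edgeSum E x + (s - x i) * linkSum E x i)
  have hg : HasDerivAt g (edgeSum E x * (k * x i ^ (k - 1)) - 1 * linkSum E x i) (x i) :=
    (((hasDerivAt_pow k (x i)).const_add _).const_mul _).sub
      ((((hasDerivAt_id (x i)).sub_const _).mul_const _).const_add _)
  have hmin : IsLocalMin g (x i) := by
    filter_upwards [lt_mem_nhds (hx i)] with s hs
    have hgx : g (x i) = 0 := by simp [g]
    have h1 := hmax (Function.update x i s) fun l => by
      by_cases h : l = i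
      · subst h; simpa using hs.le
      · simpa [h] using (hx l).le
    have h2 : ∑ l, Function.update x i s l ^ k = 1 - x i ^ k + s ^ k := by
      rw [← hx1, ← Finset.add_sum_erase _ _ (Finset.mem_univ i),
        ← Finset.add_sum_erase _ (fun l => x l ^ k) (Finset.mem_univ i)]
      have : ∑ l ∈ Finset.univ.erase i, Function.update x i s l ^ k =
          ∑ l ∈ Finset.univ.erase i, x l ^ k :=
        Finset.sum_congr rfl fun l hl => by
          rw [Function.update_of_ne (Finset.ne_of_mem_erase hl)]
      rw [this, Function.update_self]
      ring
    rw [edgeSum_update, h2] at h1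
    rw [hgx]
    exact sub_nonneg.2 h1
  have := hmin.hasDerivAt_eq_zero hg
  linarith

/-- A connected uniform family has a positive eigenvector, whose eigenvalue dominates
the quotients `edgeSum z / ∑ z i ^ k`. -/
theorem exists_pos_eigenvector [Fintype ι] [Nonempty ι] {E : Finset (Finset ι)} {k : ℕ}
    (hk : k ≠ 0) (hE : ∀ e ∈ E, e.card = k)
    (hconn : ∀ u v, Relation.ReflTransGen (fun u v => ∃ e ∈ E, u ∈ e ∧ v ∈ e) u v) :
    ∃ (x : ι → ℝ) (r : ℝ), (∀ i, 0 < x i) ∧ 0 ≤ r ∧ (∀ i, linkSum E x i = r * x i ^ (k - 1)) ∧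
      ∀ z : ι → ℝ, (∀ i, 0 ≤ z i) → k * edgeSum E z ≤ r * ∑ i, z i ^ k := by
  obtain ⟨x, hx, hx1, hmax⟩ := exists_edgeSum_maximizer hk hE
  have hpos := edgeSum_maximizer_pos hk hE hconn hx hx1 hmax
  refine ⟨x, k * edgeSum E x, hpos, mul_nonneg k.cast_nonneg (edgeSum_nonneg E hx),
    linkSum_edgeSum_maximizer hpos hx1 hmax, fun z hz => ?_⟩
  rw [mul_assoc]
  exact mul_le_mul_of_nonneg_left (hmax z hz) k.cast_nonneg

/-- Take absolute values in the eigen-equations, weight by `‖x i‖`, and sum with Euler's identity.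
-/
theorem norm_le_of_linkSum_eq [Fintype ι] {E : Finset (Finset ι)} {k : ℕ}
    (hk : k ≠ 0) (hE : ∀ e ∈ E, e.card = k) {r : ℝ}
    (hr : ∀ z : ι → ℝ, (∀ i, 0 ≤ z i) → k * edgeSum E z ≤ r * ∑ i, z i ^ k)
    {μ : ℂ} {x : ι → ℂ} (hx : x ≠ 0) (h : ∀ i, linkSum E x i = μ * x i ^ (k - 1)) :
    ‖μ‖ ≤ r := by
  have h1 : ∀ i, ‖μ‖ * ‖x i‖ ^ k ≤ ‖x i‖ * linkSum E (fun j => ‖x j‖) i := by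
    intro i
    have h2 : ‖μ‖ * ‖x i‖ ^ (k - 1) ≤ linkSum E (fun j => ‖x j‖) i := by
      rw [← norm_pow, ← norm_mul, ← h i]
      refine (norm_sum_le _ _).trans_eq (Finset.sum_congr rfl fun e _ => ?_)
      rw [norm_prod]
    calc ‖μ‖ * ‖x i‖ ^ k = ‖x i‖ * (‖μ‖ * ‖x i‖ ^ (k - 1)) := by
          rw [← mul_pow_sub_one hk ‖x i‖]; ring
      _ ≤ _ := by gcongr
  have h3 : ‖μ‖ * ∑ i, ‖x i‖ ^ k ≤ r * ∑ i, ‖x i‖ ^ k := by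
    refine le_trans ?_ (hr (fun i => ‖x i‖) fun i => norm_nonneg _)
    rw [← sum_mul_linkSum hE, Finset.mul_sum]
    exact Finset.sum_le_sum fun i _ => h1 i
  refine le_of_mul_le_mul_right h3 ?_
  obtain ⟨a, ha⟩ := Function.ne_iff.1 hx
  exact Finset.sum_pos' (fun i _ => by positivity)
    ⟨a, Finset.mem_univ a, pow_pos (norm_pos_iff.2 ha) k⟩

end EdgeFamily

/-! ### Rigidity from comparing adjacent weighted degrees -/

section WeightedBounds

variable {ι : Type*} [DecidableEq ι] [Fintype ι] [Nonempty ι] {E : Finset (Finset ι)} {k : ℕ}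

/-- If `√(d i * d j) ≤ r` for all `i ≠ j` in a common edge, where `d i = linkSum E b i / b i ^ (k - 1)`
and `r` is the eigenvalue of a positive eigenvector, then `d` is constantly `r`. -/
theorem linkSum_eq_of_forall_mul_le (hk : 3 ≤ k) (hE : ∀ e ∈ E, e.card = k)
    (hconn : ∀ u v, Relation.ReflTransGen (fun u v => ∃ e ∈ E, u ∈ e ∧ v ∈ e) u v)
    {b x : ι → ℝ} (hb : ∀ i, 0 < b i) (hx : ∀ i, 0 < x i) {r : ℝ} (hr : 0 < r)
    (heig : ∀ i, linkSum E x i = r * x i ^ (k - 1)) {d : ι → ℝ}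
    (hd : ∀ i, linkSum E b i = d i * b i ^ (k - 1))
    (h : ∀ e ∈ E, ∀ i ∈ e, ∀ j ∈ e, i ≠ j → d i * d j ≤ r ^ 2) (i : ι) : d i = r := by
  obtain ⟨y, hy, rfl⟩ : ∃ y : ι → ℝ, (∀ i, 0 < y i) ∧ x = fun i => y i * b i :=
    ⟨fun i => x i / b i, fun i => div_pos (hx i) (hb i),
      funext fun i => (div_mul_cancel₀ _ (hb i).ne').symm⟩
  have hle : ∀ i Y, (∀ e ∈ E, i ∈ e → ∀ j ∈ e, j ≠ i → y j ≤ Y) →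
      r * y i ^ (k - 1) ≤ d i * Y ^ (k - 1) := by
    intro i Y hY
    have h1 := linkSum_le_linkSum hx (z := fun j => Y * b j) fun e he hi j hj hji =>
      mul_le_mul_of_nonneg_right (hY e he hi j hj hji) (hb j).le
    rw [heig, linkSum_const_mul hE, hd, mul_pow] at h1
    refine le_of_mul_le_mul_right ?_ (pow_pos (hb i) (k - 1))
    linarith
  have hlt : ∀ i Y, (∀ e ∈ E, i ∈ e → ∀ j ∈ e, j ≠ i → y j ≤ Y) →
      ∀ e ∈ E, i ∈ e → ∀ j ∈ e, j ≠ i → y j < Y →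
      r * y i ^ (k - 1) < d i * Y ^ (k - 1) := by
    intro i Y hY e he hi j hj hji hjY
    have h1 := linkSum_lt_linkSum hx (z := fun j => Y * b j) (fun e he hi j hj hji =>
      mul_le_mul_of_nonneg_right (hY e he hi j hj hji) (hb j).le) he hi hj hji
      (mul_lt_mul_of_pos_right hjY (hb j))
    rw [heig, linkSum_const_mul hE, hd, mul_pow] at h1
    refine lt_of_mul_lt_mul_right ?_ (pow_pos (hb i) (k - 1)).le
    linarith
  obtain ⟨a, ha⟩ := Finite.exists_max y
  have hstep : ∀ e ∈ E, ∀ i ∈ e, y i = y a → ∀ l ∈ e, y l = y a := by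
    intro e he i hi hia l hl
    by_cases hli : l = i
    · rw [hli, hia]
    by_contra hne
    have hla : y l < y a := lt_of_le_of_ne (ha l) hne
    obtain ⟨j, hj, hjmax⟩ := Finset.exists_max_image
      (Finset.univ.filter fun j => j ≠ i ∧ ∃ e ∈ E, i ∈ e ∧ j ∈ e) y
      ⟨l, by simpa using ⟨hli, e, he, hi, hl⟩⟩
    obtain ⟨hji, f, hf, hif, hjf⟩ := (Finset.mem_filter.1 hj).2
    have hY : ∀ e ∈ E, i ∈ e → ∀ l ∈ e, l ≠ i → y l ≤ y j := fun e he hi l hl hli =>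
      hjmax l (by simpa using ⟨hli, e, he, hi, hl⟩)
    have hM : ∀ e ∈ E, j ∈ e → ∀ l ∈ e, l ≠ j → y l ≤ y a := fun _ _ _ l _ _ => ha l
    have h1 := hle i (y j) hY
    have h2 := hle j (y a) hM
    have hp := pow_pos (hy a) (k - 1)
    have hq := pow_pos (hy j) (k - 1)
    have h3 := h f hf i hif j hjf hji.symm
    rw [hia] at h1
    have hdi : 0 < d i := pos_of_mul_pos_left ((mul_pos hr hp).trans_le h1) hq.le
    have hdj : 0 < d j := pos_of_mul_pos_left ((mul_pos hr hq).trans_le h2) hp.le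
    have h4 : r * y a ^ (k - 1) * (r * y j ^ (k - 1)) <
        d i * y j ^ (k - 1) * (d j * y a ^ (k - 1)) := by
      -- If `y j` is below the maximum, the equation at `j` is strict: as `k ≥ 3`, the edge `f` has
      -- a third vertex `m`, and `y m ≤ y j`. Otherwise the neighbour `l` makes the equation at `i`
      -- strict.
      rcases (ha j).lt_or_eq with hja | hja
      · obtain ⟨m, hm⟩ : ((f.erase i).erase j).Nonempty := by
          rw [← Finset.card_pos, Finset.card_erase_of_mem (Finset.mem_erase.2 ⟨hji, hjf⟩),
            Finset.card_erase_of_mem hif, hE f hf]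
          omega
        simp only [Finset.mem_erase] at hm
        have h5 := hlt j (y a) hM f hf hjf m hm.2.2 hm.1
          ((hY f hf hif m hm.2.2 hm.2.1).trans_lt hja)
        exact mul_lt_mul' h1 h5 (by positivity) (by positivity)
      · have h5 := hlt i (y j) hY e he hi l hl hli (hja ▸ hla)
        rw [hia] at h5
        exact mul_lt_mul h5 h2 (by positivity) (by positivity)
    have h5 : d i * d j * (y a ^ (k - 1) * y j ^ (k - 1)) ≤
        r ^ 2 * (y a ^ (k - 1) * y j ^ (k - 1)) := by gcongr
    linarith
  have hconst : ∀ l, y l = y a := forall_of_step hconn (P := fun l => y l = y a) rfl hstep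
  have h1 := heig i
  rw [show (fun i => y i * b i) = fun i => y a * b i from funext fun l => by rw [hconst l],
    linkSum_const_mul hE, hd, mul_pow] at h1
  have := mul_pos (pow_pos (hy a) (k - 1)) (pow_pos (hb i) (k - 1))
  refine mul_right_cancel₀ this.ne' ?_
  linarith

/-- If `r ≤ √(d i * d j)` for all `i ≠ j` in a common edge, where `d i = linkSum E b i / b i ^ (k - 1)`
and `r` is the eigenvalue of a positive eigenvector, then `d` is constantly `r`. -/
theorem linkSum_eq_of_forall_le_mul (hk : 3 ≤ k) (hE : ∀ e ∈ E, e.card = k)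
    (hconn : ∀ u v, Relation.ReflTransGen (fun u v => ∃ e ∈ E, u ∈ e ∧ v ∈ e) u v)
    {b x : ι → ℝ} (hb : ∀ i, 0 < b i) (hx : ∀ i, 0 < x i) {r : ℝ} (hr : 0 < r)
    (heig : ∀ i, linkSum E x i = r * x i ^ (k - 1)) {d : ι → ℝ} (hd0 : ∀ i, 0 < d i)
    (hd : ∀ i, linkSum E b i = d i * b i ^ (k - 1))
    (h : ∀ e ∈ E, ∀ i ∈ e, ∀ j ∈ e, i ≠ j → r ^ 2 ≤ d i * d j) (i : ι) : d i = r := by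
  obtain ⟨y, hy, rfl⟩ : ∃ y : ι → ℝ, (∀ i, 0 < y i) ∧ x = fun i => y i * b i :=
    ⟨fun i => x i / b i, fun i => div_pos (hx i) (hb i),
      funext fun i => (div_mul_cancel₀ _ (hb i).ne').symm⟩
  have hle : ∀ i Y, 0 < Y → (∀ e ∈ E, i ∈ e → ∀ j ∈ e, j ≠ i → Y ≤ y j) →
      d i * Y ^ (k - 1) ≤ r * y i ^ (k - 1) := by
    intro i Y hY0 hY
    have h1 := linkSum_le_linkSum (x := fun j => Y * b j) (fun j => mul_pos hY0 (hb j))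
      fun e he hi j hj hji => mul_le_mul_of_nonneg_right (hY e he hi j hj hji) (hb j).le
    rw [heig, linkSum_const_mul hE, hd, mul_pow] at h1
    refine le_of_mul_le_mul_right ?_ (pow_pos (hb i) (k - 1))
    linarith
  have hlt : ∀ i Y, 0 < Y → (∀ e ∈ E, i ∈ e → ∀ j ∈ e, j ≠ i → Y ≤ y j) →
      ∀ e ∈ E, i ∈ e → ∀ j ∈ e, j ≠ i → Y < y j →
      d i * Y ^ (k - 1) < r * y i ^ (k - 1) := by
    intro i Y hY0 hY e he hi j hj hji hjY
    have h1 := linkSum_lt_linkSum (x := fun j => Y * b j) (fun j => mul_pos hY0 (hb j))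
      (fun e he hi j hj hji => mul_le_mul_of_nonneg_right (hY e he hi j hj hji) (hb j).le)
      he hi hj hji (mul_lt_mul_of_pos_right hjY (hb j))
    rw [heig, linkSum_const_mul hE, hd, mul_pow] at h1
    refine lt_of_mul_lt_mul_right ?_ (pow_pos (hb i) (k - 1)).le
    linarith
  obtain ⟨a, ha⟩ := Finite.exists_min y
  have hstep : ∀ e ∈ E, ∀ i ∈ e, y i = y a → ∀ l ∈ e, y l = y a := by
    intro e he i hi hia l hl
    by_cases hli : l = i
    · rw [hli, hia]
    by_contra hne
    have hla : y a < y l := lt_of_le_of_ne (ha l) (Ne.symm hne)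
    obtain ⟨j, hj, hjmin⟩ := Finset.exists_min_image
      (Finset.univ.filter fun j => j ≠ i ∧ ∃ e ∈ E, i ∈ e ∧ j ∈ e) y
      ⟨l, by simpa using ⟨hli, e, he, hi, hl⟩⟩
    obtain ⟨hji, f, hf, hif, hjf⟩ := (Finset.mem_filter.1 hj).2
    have hY : ∀ e ∈ E, i ∈ e → ∀ l ∈ e, l ≠ i → y j ≤ y l := fun e he hi l hl hli =>
      hjmin l (by simpa using ⟨hli, e, he, hi, hl⟩)
    have hM : ∀ e ∈ E, j ∈ e → ∀ l ∈ e, l ≠ j → y a ≤ y l := fun _ _ _ l _ _ => ha l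
    have h1 := hle i (y j) (hy j) hY
    have h2 := hle j (y a) (hy a) hM
    have hp := pow_pos (hy a) (k - 1)
    have hq := pow_pos (hy j) (k - 1)
    have h3 := h f hf i hif j hjf hji.symm
    have hdi := hd0 i
    have hdj := hd0 j
    rw [hia] at h1
    have h4 : d i * y j ^ (k - 1) * (d j * y a ^ (k - 1)) <
        r * y a ^ (k - 1) * (r * y j ^ (k - 1)) := by
      -- The third vertex `m` of `f` now satisfies `y a < y j ≤ y m`, giving strictness at `j`;
      -- otherwise `l` gives it at `i`.
      rcases (ha j).lt_or_eq with hja | hja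
      · obtain ⟨m, hm⟩ : ((f.erase i).erase j).Nonempty := by
          rw [← Finset.card_pos, Finset.card_erase_of_mem (Finset.mem_erase.2 ⟨hji, hjf⟩),
            Finset.card_erase_of_mem hif, hE f hf]
          omega
        simp only [Finset.mem_erase] at hm
        have h5 := hlt j (y a) (hy a) hM f hf hjf m hm.2.2 hm.1
          (hja.trans_le (hY f hf hif m hm.2.2 hm.2.1))
        exact mul_lt_mul' h1 h5 (by positivity) (by positivity)
      · have h5 := hlt i (y j) (hy j) hY e he hi l hl hli (hja ▸ hla)
        rw [hia] at h5
        exact mul_lt_mul h5 h2 (by positivity) (by positivity)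
    have h5 : r ^ 2 * (y a ^ (k - 1) * y j ^ (k - 1)) ≤
        d i * d j * (y a ^ (k - 1) * y j ^ (k - 1)) := by gcongr
    linarith
  have hconst : ∀ l, y l = y a := forall_of_step hconn (P := fun l => y l = y a) rfl hstep
  have h1 := heig i
  rw [show (fun i => y i * b i) = fun i => y a * b i from funext fun l => by rw [hconst l],
    linkSum_const_mul hE, hd, mul_pow] at h1
  have := mul_pos (pow_pos (hy a) (k - 1)) (pow_pos (hb i) (k - 1))
  refine mul_right_cancel₀ this.ne' ?_
  linarith

end WeightedBounds

/-! ### From the adjacency tensor to sums over edges -/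

theorem card_filter_image_univ_eq {α β : Type*} [Fintype α] [DecidableEq α] [Fintype β]
    [DecidableEq β] (s : Finset β) (hs : s.card = Fintype.card α) :
    (Finset.univ.filter fun t : α → β => Finset.univ.image t = s).card =
      (Fintype.card α).factorial := by
  have e0 : α ≃ s := Fintype.equivOfCardEq (by simp [hs])
  rw [← Fintype.card_equiv e0, ← Finset.card_univ]
  symm
  refine Finset.card_bij (fun e _ a => (e a : β)) (fun e _ => ?_) (fun e _ f _ h => ?_)
    fun t ht => ?_
  · rw [Finset.mem_filter]
    refine ⟨Finset.mem_univ _, Finset.ext fun b => ?_⟩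
    simp only [Finset.mem_image, Finset.mem_univ, true_and]
    exact ⟨fun ⟨a, ha⟩ => ha ▸ (e a).2, fun hb => ⟨e.symm ⟨b, hb⟩, by simp⟩⟩
  · ext a
    exact congrFun h a
  · have him := (Finset.mem_filter.1 ht).2
    let g : α → s := fun a => ⟨t a, him ▸ Finset.mem_image_of_mem t (Finset.mem_univ a)⟩
    have hsurj : Function.Surjective g := by
      rintro ⟨b, hb⟩
      rw [← him, Finset.mem_image] at hb
      obtain ⟨a, -, ha⟩ := hb
      exact ⟨a, Subtype.ext ha⟩
    have hbij : Function.Bijective g :=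
      (Fintype.bijective_iff_surjective_and_card g).2 ⟨hsurj, by simp [hs]⟩
    exact ⟨Equiv.ofBijective g hbij, Finset.mem_univ _, rfl⟩

theorem prod_comp_of_image_univ_eq {α β M : Type*} [Fintype α] [DecidableEq β]
    [CommMonoid M] {s : Finset β} (hs : s.card = Fintype.card α) {t : α → β}
    (ht : Finset.univ.image t = s) (x : β → M) : ∏ a, x (t a) = ∏ j ∈ s, x j := by
  subst ht
  rw [Finset.prod_image]
  exact Finset.card_image_iff.1 hs

open scoped Classical in
/-- The edges of a hypergraph on `Fin n`, as finsets. -/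
noncomputable def Hypergraph.edges {n : ℕ} (H : Hypergraph (Fin n)) : Finset (Finset (Fin n)) :=
  Finset.univ.filter fun e => (e : Set (Fin n)) ∈ H.edgeSet

namespace Hypergraph

variable {n k : ℕ} {H : Hypergraph (Fin n)}

theorem mem_edges {e : Finset (Fin n)} : e ∈ H.edges ↔ (e : Set (Fin n)) ∈ H.edgeSet := by
  simp [edges]

theorem IsUniform.card_eq (hH : H.IsUniform k) : ∀ e ∈ H.edges, e.card = k := fun e he => by
  rw [← hH _ (mem_edges.1 he), Set.ncard_coe_finset]

theorem adj_iff_exists_mem_edges {u v : Fin n} : H.Adj u v ↔ ∃ e ∈ H.edges, u ∈ e ∧ v ∈ e := by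
  classical
  constructor
  · rintro ⟨e, he, hu, hv⟩
    exact ⟨e.toFinset, mem_edges.2 (by simpa using he), by simpa using hu, by simpa using hv⟩
  · rintro ⟨e, he, hu, hv⟩
    exact ⟨e, mem_edges.1 he, hu, hv⟩

theorem weightedDegree_eq (b : Fin n → ℝ) (i : Fin n) :
    H.weightedDegree k b i = (b i ^ (k - 1))⁻¹ * linkSum H.edges b i := by
  classical
  rw [weightedDegree, linkSum, edges, Finset.filter_filter]

/-- Each edge through `i` comes from exactly `(k - 1)!` tuples, the orderings of its other vertices,
which cancels the tensor's normalization. -/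
theorem adjacencyTensor_apply (hk : 3 ≤ k) (hH : H.IsUniform k) (x : Fin n → ℂ) (i : Fin n) :
    (H.adjacencyTensor k).apply x i = linkSum H.edges x i := by
  classical
  have hterm : ∀ t : Fin (k - 1) → Fin n, H.adjacencyTensor k i t * ∏ s, x (t s) =
      ∑ e ∈ H.edges with i ∈ e,
        if Finset.univ.image t = e.erase i then
          1 / ((k - 1).factorial : ℂ) * ∏ j ∈ e.erase i, x j else 0 := by
    intro t
    by_cases h : insert i (Finset.univ.image t) ∈ H.edges
    · have hcard := hH.card_eq _ h
      have hle : (Finset.univ.image t).card ≤ k - 1 :=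
        Finset.card_image_le.trans_eq (by simp)
      -- A tuple hitting `i` would leave at most `k - 1` distinct vertices, too few for an edge.
      have hni : i ∉ Finset.univ.image t := fun hi => by
        rw [Finset.insert_eq_of_mem hi] at hcard
        omega
      rw [Finset.sum_eq_single (insert i (Finset.univ.image t))]
      · rw [Finset.erase_insert hni, if_pos rfl]
        rw [Finset.card_insert_of_notMem hni] at hcard
        rw [prod_comp_of_image_univ_eq (by simp; omega) rfl x, adjacencyTensor, if_pos]
        simpa using mem_edges.1 h
      · intro e he hne
        refine if_neg fun h' => hne ?_
        rw [h', Finset.insert_erase (Finset.mem_filter.1 he).2]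
      · intro h'
        exact absurd (Finset.mem_filter.2 ⟨h, Finset.mem_insert_self i _⟩) h'
    · rw [adjacencyTensor, if_neg, zero_mul]
      · refine (Finset.sum_eq_zero fun e he => if_neg fun h' => h ?_).symm
        rw [Finset.mem_filter] at he
        rw [h', Finset.insert_erase he.2]
        exact he.1
      · intro h'
        exact h (mem_edges.2 (by simpa using h'))
  rw [CTensor.apply, Finset.sum_congr rfl fun t _ => hterm t, Finset.sum_comm, linkSum]
  refine Finset.sum_congr rfl fun e he => ?_
  rw [Finset.mem_filter] at he
  rw [← Finset.sum_filter, Finset.sum_const, card_filter_image_univ_eq, Fintype.card_fin,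
    nsmul_eq_mul, ← mul_assoc, mul_one_div_cancel, one_mul]
  · exact_mod_cast (k - 1).factorial_ne_zero
  · rw [Finset.card_erase_of_mem he.2, hH.card_eq e he.1, Fintype.card_fin]

theorem IsConnected.reflTransGen (hconn : H.IsConnected) (hV : H.vertexSet = Set.univ)
    (u v : Fin n) : Relation.ReflTransGen (fun u v => ∃ e ∈ H.edges, u ∈ e ∧ v ∈ e) u v :=
  Relation.ReflTransGen.mono (fun _ _ => adj_iff_exists_mem_edges.1) _ _
    (hconn u (hV ▸ Set.mem_univ u) v (hV ▸ Set.mem_univ v))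

theorem mem_adjPairs {i j : Fin n} :
    (i, j) ∈ H.adjPairs ↔ i ≠ j ∧ ∃ e ∈ H.edges, i ∈ e ∧ j ∈ e := by
  classical
  rw [← adj_iff_exists_mem_edges, adjPairs, Finset.mem_filter, Adj]
  simp

theorem linkSum_edges_pos (hconn : H.IsConnected) (hV : H.vertexSet = Set.univ)
    (hk : k ≠ 0) (hH : H.IsUniform k) (hE : H.edgeSet.Nonempty) {x : Fin n → ℝ}
    (hx : ∀ i, 0 < x i) (i : Fin n) : 0 < linkSum H.edges x i := by
  obtain ⟨e, he, hi⟩ : ∃ e ∈ H.edges, i ∈ e := by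
    classical
    obtain ⟨f, hf⟩ := hE
    have hf' : f.toFinset ∈ H.edges := mem_edges.2 (by simpa using hf)
    obtain ⟨u, hu⟩ : f.toFinset.Nonempty := by
      rw [← Finset.card_pos, hH.card_eq _ hf']
      omega
    exact forall_of_step (hconn.reflTransGen hV) (P := fun i => ∃ e ∈ H.edges, i ∈ e)
      ⟨_, hf', hu⟩ (fun e he _ _ _ j hj => ⟨e, he, hj⟩) i
  exact Finset.sum_pos (fun e _ => Finset.prod_pos fun j _ => hx j)
    ⟨e, Finset.mem_filter.2 ⟨he, hi⟩⟩

/-- The Perron eigenvector of a connected uniform hypergraph. -/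
theorem exists_perron_eigenvector (hk : 3 ≤ k) (hV : H.vertexSet = Set.univ)
    (hH : H.IsUniform k) (hconn : H.IsConnected) (hE : H.edgeSet.Nonempty) :
    IsGreatest (H.adjacencyTensor k).eigenvalueModuli (H.adjacencyTensor k).spectralRadius ∧
      0 < (H.adjacencyTensor k).spectralRadius ∧
      ∃ x : Fin n → ℝ, (∀ i, 0 < x i) ∧
        ∀ i, linkSum H.edges x i = (H.adjacencyTensor k).spectralRadius * x i ^ (k - 1) := by
  have hk0 : k ≠ 0 := by omega
  obtain ⟨p, -⟩ := H.adjPairs_nonempty hk hH hE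
  have : Nonempty (Fin n) := ⟨p.1⟩
  obtain ⟨x, r, hx, hr0, heig, hmax⟩ :=
    exists_pos_eigenvector hk0 hH.card_eq (hconn.reflTransGen hV)
  have hgr : IsGreatest (H.adjacencyTensor k).eigenvalueModuli r := by
    constructor
    · refine ⟨(r : ℂ), ⟨fun i => (x i : ℂ), fun h => ?_, fun i => ?_⟩, ?_⟩
      · exact (hx p.1).ne' (by simpa using congrFun h p.1)
      · rw [adjacencyTensor_apply hk hH]
        have := congrArg (fun s : ℝ => (s : ℂ)) (heig i)
        simpa [linkSum] using this
      · simp [abs_of_nonneg hr0]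
    · rintro _ ⟨μ, ⟨z, hz, h⟩, rfl⟩
      refine norm_le_of_linkSum_eq hk0 hH.card_eq hmax hz fun i => ?_
      rw [← adjacencyTensor_apply hk hH, h]
  have hrs : (H.adjacencyTensor k).spectralRadius = r := hgr.csSup_eq
  rw [hrs]
  refine ⟨hgr, hr0.lt_of_ne fun h => ?_, x, hx, heig⟩
  have := linkSum_edges_pos hconn hV hk0 hH hE hx p.1
  rw [heig, ← h, zero_mul] at this
  exact this.false

end Hypergraph

/-! ### Bounds and equality cases -/

theorem theorem3p2 {n k : ℕ} (hk : 3 ≤ k) (b : Fin n → ℝ) (hb : ∀ i, 0 < b i)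
    (H : Hypergraph (Fin n)) (hV : H.vertexSet = Set.univ) (hH : H.IsUniform k)
    (hconn : H.IsConnected) (hE : H.edgeSet.Nonempty) :
    IsGreatest (H.adjacencyTensor k).eigenvalueModuli (H.adjacencyTensor k).spectralRadius ∧
    H.adjPairs.inf' (H.adjPairs_nonempty hk hH hE)
        (fun p => √(H.weightedDegree k b p.1 * H.weightedDegree k b p.2)) ≤
      (H.adjacencyTensor k).spectralRadius ∧
    (H.adjacencyTensor k).spectralRadius ≤
      H.adjPairs.sup' (H.adjPairs_nonempty hk hH hE)
        (fun p => √(H.weightedDegree k b p.1 * H.weightedDegree k b p.2)) ∧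
    (H.adjPairs.inf' (H.adjPairs_nonempty hk hH hE)
        (fun p => √(H.weightedDegree k b p.1 * H.weightedDegree k b p.2)) =
      (H.adjacencyTensor k).spectralRadius ↔
        ∀ i j, H.weightedDegree k b i = H.weightedDegree k b j) ∧
    ((H.adjacencyTensor k).spectralRadius =
      H.adjPairs.sup' (H.adjPairs_nonempty hk hH hE)
        (fun p => √(H.weightedDegree k b p.1 * H.weightedDegree k b p.2)) ↔
        ∀ i j, H.weightedDegree k b i = H.weightedDegree k b j) := by
  have hk0 : k ≠ 0 := by omega
  obtain ⟨hgr, hr, x, hx, heig⟩ := Hypergraph.exists_perron_eigenvector hk hV hH hconn hE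
  set r := (H.adjacencyTensor k).spectralRadius
  set d := H.weightedDegree k b
  have hne := H.adjPairs_nonempty hk hH hE
  obtain ⟨p, -⟩ := id hne
  have : Nonempty (Fin n) := ⟨p.1⟩
  have hd : ∀ i, linkSum H.edges b i = d i * b i ^ (k - 1) := fun i => by
    have := (pow_pos (hb i) (k - 1)).ne'
    simp only [d, Hypergraph.weightedDegree_eq]
    field_simp
  have hd0 : ∀ i, 0 < d i := fun i => by
    have := Hypergraph.linkSum_edges_pos hconn hV hk0 hH hE hb i
    rw [hd] at this
    exact pos_of_mul_pos_left this (pow_pos (hb i) _).le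
  have hupper : H.adjPairs.sup' hne (fun p => √(d p.1 * d p.2)) ≤ r → ∀ i, d i = r := by
    intro h
    refine linkSum_eq_of_forall_mul_le hk hH.card_eq (hconn.reflTransGen hV) hb hx hr heig hd
      fun e he i hi j hj hij => ?_
    exact (Real.sqrt_le_left hr.le).1 ((Finset.sup'_le_iff hne _).1 h (i, j)
      (Hypergraph.mem_adjPairs.2 ⟨hij, e, he, hi, hj⟩))
  have hlower : r ≤ H.adjPairs.inf' hne (fun p => √(d p.1 * d p.2)) → ∀ i, d i = r := by
    intro h
    refine linkSum_eq_of_forall_le_mul hk hH.card_eq (hconn.reflTransGen hV) hb hx hr heig hd0 hd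
      fun e he i hi j hj hij => ?_
    exact (Real.le_sqrt' hr).1 ((Finset.le_inf'_iff hne _).1 h (i, j)
      (Hypergraph.mem_adjPairs.2 ⟨hij, e, he, hi, hj⟩))
  have hconst : ∀ c, (∀ i, d i = c) →
      H.adjPairs.inf' hne (fun p => √(d p.1 * d p.2)) = c ∧
      H.adjPairs.sup' hne (fun p => √(d p.1 * d p.2)) = c := by
    intro c hc
    have h : (fun p : Fin n × Fin n => √(d p.1 * d p.2)) = fun _ => c := by
      funext p
      rw [hc, hc, Real.sqrt_mul_self (hc p.1 ▸ (hd0 p.1).le)]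
    rw [h]
    exact ⟨Finset.inf'_const _ _, Finset.sup'_const _ _⟩
  -- A violated bound satisfies the hypothesis of the rigidity statement, which then forces
  -- equality.
  have hle : H.adjPairs.inf' hne (fun p => √(d p.1 * d p.2)) ≤ r := by
    by_contra! h
    exact h.ne (hconst r (hlower h.le)).1.symm
  have hge : r ≤ H.adjPairs.sup' hne (fun p => √(d p.1 * d p.2)) := by
    by_contra! h
    exact h.ne (hconst r (hupper h.le)).2
  have heq : (∀ i j, d i = d j) → ∀ i, d i = r := by
    intro h
    obtain ⟨h1, h2⟩ := hconst (d p.1) fun i => h i p.1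
    have : d p.1 = r := le_antisymm (h1 ▸ hle) (h2 ▸ hge)
    exact fun i => (h i p.1).trans this
  refine ⟨hgr, hle, hge, ⟨fun h i j => ?_, fun h => (hconst r (heq h)).1⟩,
    ⟨fun h i j => ?_, fun h => (hconst r (heq h)).2.symm⟩⟩
  · rw [hlower h.ge i, hlower h.ge j]
  · rw [hupper h.ge i, hupper h.ge j]
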